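/- Let $n \ge 1$, let $U = \{z \in \mathbb{C}^n : |z_j| < 1,\ j = 1,\dots,n\}$ be the unit polydisc, and let $f(z) = z^A = z_1^{k_1}\cdots z_n^{k_n}$ be a monomial, where $A = (k_1,\dots,k_n)$ consists of non-negative integers that are not all zero. Write $\partial f = \left(\frac{\partial f}{\partial z_1},\dots,\frac{\partial f}{\partial z_n}\right)$ and let $|\partial f|$ be its Euclidean norm. Then there is a constant $c > 0$ (depending on $n$ and $A$) such that, as $\varepsilon \to 0^+$, $$I(\varepsilon) = \int_{\{z\in U:\ |f(z)| = \varepsilon\}} |\partial f|\, dS \sim c\,\varepsilon, \qquad J(\varepsilon) = \int_{\{z\in U:\ |f(z)| < \varepsilon\}} |\partial f|^2\, dV \sim \frac{c}{2}\,\varepsilon^2,$$ with the same constant $c$ in both formulas. Here $dS$ is the surface measure (the $(2n-1)$-dimensional Hausdorff measure on $\mathbb{C}^n = \mathbb{R}^{2n}$, normalized to agree with Euclidean surface area), $dV$ is the Lebesgue measure, and $F(\varepsilon) \sim G(\varepsilon)$ means $\lim_{\varepsilon\to 0^+} F(\varepsilon)/G(\varepsilon) = 1$. -/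

import Mathlib

open MeasureTheory Filter Topology

/-- The complex gradient `∂f = (∂f/∂z₁, …, ∂f/∂zₙ)` of a holomorphic function `f` on `ℂⁿ`.
Its Euclidean norm is `|∂f| = (∑ⱼ |∂f/∂zⱼ|²)^(1/2)`. -/
noncomputable def complexGrad {n : ℕ} (f : EuclideanSpace ℂ (Fin n) → ℂ)
    (z : EuclideanSpace ℂ (Fin n)) : EuclideanSpace ℂ (Fin n) :=
  WithLp.toLp 2 fun j => fderiv ℂ f z (EuclideanSpace.single j 1)

/-- The open unit polydisc `{z ∈ ℂⁿ : |zⱼ| < 1 for all j}`. -/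
def unitPolydisc (n : ℕ) : Set (EuclideanSpace ℂ (Fin n)) :=
  {z | ∀ j, ‖z j‖ < 1}

/-- The monomial `z ↦ z^A = z₁^{k₁} ⋯ zₙ^{kₙ}` with exponent vector `A = (k₁, …, kₙ)`. -/
def monomialFun {n : ℕ} (A : Fin n → ℕ) (z : EuclideanSpace ℂ (Fin n)) : ℂ :=
  ∏ j, z j ^ A j

/-- `I(ε) = ∫_{z ∈ U, |f(z)| = ε} |∂f| dS`, where `U` is the unit polydisc in `ℂⁿ` and `dS` is
the surface measure, that is, the `(2n-1)`-dimensional Hausdorff measure of `ℂⁿ = ℝ²ⁿ` in its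
Euclidean normalization (so that it restricts to the Lebesgue measure on a real hyperplane). -/
noncomputable def levelEnergy {n : ℕ} (f : EuclideanSpace ℂ (Fin n) → ℂ) (ε : ℝ) : ℝ :=
  ∫ z in {z | z ∈ unitPolydisc n ∧ ‖f z‖ = ε}, ‖complexGrad f z‖ ∂μHE[2 * n - 1]

/-- `J(ε) = ∫_{z ∈ U, |f(z)| < ε} |∂f|² dV`, where `U` is the unit polydisc in `ℂⁿ` and `dV` is
the Lebesgue measure of `ℂⁿ = ℝ²ⁿ`. -/
noncomputable def sublevelEnergy {n : ℕ} (f : EuclideanSpace ℂ (Fin n) → ℂ) (ε : ℝ) : ℝ :=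
  ∫ z in {z | z ∈ unitPolydisc n ∧ ‖f z‖ < ε}, ‖complexGrad f z‖ ^ 2

/-!
In logarithmic coordinates `z j = exp (ζ j)` the level sets of a monomial become parallel real
hyperplanes: `‖z^A‖ = exp ⟪k, ζ⟫`, where `k` is the exponent vector. Write `e = k / ‖k‖`, so that
`‖z^A‖ = ε` is the hyperplane `t • e + e^⊥` with `t = log ε / ‖k‖`. Both energies are pulled back by
the coordinatewise exponential.

* For `J` this is the usual change of variables, with Jacobian `∏ ‖z j‖ ^ 2`.
* For `I` it is the area formula for the Euclidean Hausdorff measure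
  (`lintegral_image_eq_lintegral_normDet_mul`), together with the volume factor of an invertible
  linear map `L` on the hyperplane `e^⊥`, which is `|det L| * ‖(L⁻¹)† e‖`
  (`normDet_comp_subtype_orthogonal`).

The points with a vanishing coordinate, which the exponential misses, lie in real codimension two
and are null for both measures. Since
`∏ ‖z j‖ ^ 2 * ‖∂f‖ ^ 2 = ‖f‖ ^ 2 * ∑ i, k i ^ 2 * ∏ j ≠ i, ‖z j‖ ^ 2`, the results are
`I ε = ε / ‖k‖ * D (log ε / ‖k‖)` (`levelEnergy_eq`) and, by Fubini along `e`,
`J ε = ∫ t in Iio (log ε / ‖k‖), exp (2 * ‖k‖ * t) * D t` (`lintegral_sublevel_eq`),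
with one and the same function `D = sliceMass A`: the integral of that weight over the part of the
hyperplane `t • e + e^⊥` that corresponds to the polydisc.

It remains to see that `D t` has a finite positive limit as `t → -∞`. The `i`-th summand of the
weight does not depend on `ζ i`. Translating inside `e^⊥` replaces the shift `t • e` by a multiple
of the `i`-th coordinate vector, so `t` enters this summand only through the constraint
`Re (ζ i) < 0`, which relaxes as `t` decreases. Hence `D` is antitone and its limit is its supremum,
which is finite because the volume of the polydisc controls it (`iSup_sliceMass_lt_top`).
With `c = (⨆ t, D t) / ‖k‖` the first asymptotic relation is immediate, and the second follows from
`D (log ε / ‖k‖) ≤ D t ≤ ⨆ s, D s` on the domain of integration.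
-/

/-! ### The area formula for the Euclidean Hausdorff measure -/

section AreaFormula

open Set Module
open scoped NNReal ENNReal

/-- If `b` expands distances on `s` at most `C` times as much as `a` does, then the measure of
`b '' s` is at most `C ^ d` times that of `a '' s`. Neither map is assumed injective: `b` factors
through `a` on `s`. -/
theorem euclideanHausdorffMeasure_image_le_of_edist_le {X Y Z : Type*}
    [EMetricSpace Y] [MeasurableSpace Y] [BorelSpace Y]
    [EMetricSpace Z] [MeasurableSpace Z] [BorelSpace Z] {a : X → Y} {b : X → Z} {s : Set X}
    {C : ℝ≥0} (d : ℕ) (h : ∀ x ∈ s, ∀ y ∈ s, edist (b x) (b y) ≤ C * edist (a x) (a y)) :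
    μHE[d] (b '' s) ≤ (C : ℝ≥0∞) ^ d * μHE[d] (a '' s) := by
  rcases s.eq_empty_or_nonempty with rfl | ⟨x₀, -⟩
  · simp
  have : Nonempty X := ⟨x₀⟩
  set g : Y → Z := fun y => b (Function.invFunOn a s y) with hg
  have hgs : ∀ x ∈ s, g (a x) = b x := by
    intro x hx
    have hm : Function.invFunOn a s (a x) ∈ s := Function.invFunOn_mem ⟨x, hx, rfl⟩
    have he : a (Function.invFunOn a s (a x)) = a x := Function.invFunOn_eq ⟨x, hx, rfl⟩
    have := h _ hm _ hx
    rw [he, edist_self, mul_zero] at this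
    exact edist_le_zero.1 this
  have hlip : LipschitzOnWith C g (a '' s) := by
    rintro _ ⟨x, hx, rfl⟩ _ ⟨y, hy, rfl⟩
    rw [hgs x hx, hgs y hy]
    exact h x hx y hy
  have himg : g '' (a '' s) = b '' s := by
    rw [image_image]
    exact image_congr hgs
  have key := hlip.hausdorffMeasure_image_le (d := (d : ℝ)) d.cast_nonneg
  rw [himg, ENNReal.rpow_natCast] at key
  simp only [Measure.euclideanHausdorffMeasure_def, Measure.smul_apply, ENNReal.smul_def,
    smul_eq_mul]
  calc _ ≤ _ * ((C : ℝ≥0∞) ^ d * μH[d] (a '' s)) := mul_le_mul_right key _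
    _ = _ := mul_left_comm _ _ _

theorem continuous_normDet {E F : Type*} [NormedAddCommGroup E] [InnerProductSpace ℝ E]
    [FiniteDimensional ℝ E] [NormedAddCommGroup F] [InnerProductSpace ℝ F] [CompleteSpace F] :
    Continuous fun L : E →L[ℝ] F => (L : E →ₗ[ℝ] F).normDet := by
  have : CompleteSpace E := FiniteDimensional.complete ℝ E
  have h : (fun L : E →L[ℝ] F => (L : E →ₗ[ℝ] F).normDet)
      = fun L => √((ContinuousLinearMap.adjoint L ∘L L).det) := by
    ext L
    rw [← L.normDet_sq]
    exact (Real.sqrt_sq (LinearMap.normDet_nonneg _)).symm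
  rw [h]
  refine Real.continuous_sqrt.comp (ContinuousLinearMap.continuous_det.comp ?_)
  exact (ContinuousLinearMap.adjoint.continuous).clm_comp continuous_id

variable {E F : Type*} [NormedAddCommGroup E] [InnerProductSpace ℝ E] [FiniteDimensional ℝ E]
  [MeasurableSpace E] [BorelSpace E]
  [NormedAddCommGroup F] [InnerProductSpace ℝ F] [MeasurableSpace F] [BorelSpace F]

/-- Near an injective linear map `L`, the area formula holds up to a factor arbitrarily close
to `1`: a map well approximated by `L` is almost isometric to `L` itself. -/
theorem exists_measure_image_bounds_of_approximatesLinearOn (L : E →L[ℝ] F)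
    (hL : Function.Injective L) {η : ℝ≥0} (hη : 1 < η) :
    ∃ δ : ℝ≥0, 0 < δ ∧ ∀ (φ : E → F) (s : Set E), ApproximatesLinearOn φ L s δ →
      μHE[finrank ℝ E] (φ '' s) ≤ η * (ENNReal.ofReal L.normDet * volume s) ∧
      ENNReal.ofReal L.normDet * volume s ≤ η * μHE[finrank ℝ E] (φ '' s) := by
  obtain ⟨K, hK, hLK⟩ := (L : E →ₗ[ℝ] F).exists_antilipschitzWith (LinearMap.ker_eq_bot.2 hL)
  set d := finrank ℝ E
  -- both Lipschitz constants `1 + δK` and `(1 - δK)⁻¹` tend to `1` with `δ`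
  have h1 : Tendsto (fun δ : ℝ => (1 + δ * K) ^ d) (𝓝[>] 0) (𝓝 1) := by
    have : ContinuousAt (fun δ : ℝ => (1 + δ * K) ^ d) 0 := by fun_prop
    simpa [ContinuousAt] using this.tendsto.mono_left nhdsWithin_le_nhds
  have h2 : Tendsto (fun δ : ℝ => ((1 - δ * K)⁻¹) ^ d) (𝓝[>] 0) (𝓝 1) := by
    have : ContinuousAt (fun δ : ℝ => ((1 - δ * K)⁻¹) ^ d) 0 := by
      apply ContinuousAt.pow
      apply ContinuousAt.inv₀ (by fun_prop) (by simp)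
    simpa [ContinuousAt] using this.tendsto.mono_left nhdsWithin_le_nhds
  have h3 : Tendsto (fun δ : ℝ => 1 - δ * K) (𝓝[>] 0) (𝓝 1) := by
    have : ContinuousAt (fun δ : ℝ => 1 - δ * K) 0 := by fun_prop
    simpa [ContinuousAt] using this.tendsto.mono_left nhdsWithin_le_nhds
  have hη' : (1 : ℝ) < η := by exact_mod_cast hη
  obtain ⟨δ, hδ1, hδ2, hδ3, hδ⟩ := ((h1.eventually_lt_const hη').and
    ((h2.eventually_lt_const hη').and ((h3.eventually_const_lt one_pos).and
      self_mem_nhdsWithin))).exists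
  have hδ : 0 < δ := hδ
  lift δ to ℝ≥0 using hδ.le
  refine ⟨δ, by exact_mod_cast hδ, fun φ s hφ => ?_⟩
  have himg : μHE[d] (L '' s) = ENNReal.ofReal L.normDet * volume s :=
    (L : E →ₗ[ℝ] F).euclideanHausdorffMeasure_image_eq_normDet_mul_volume s
  have hanti : ∀ x y, dist x y ≤ K * dist (L x) (L y) := fun x y => hLK.le_mul_dist x y
  have happ : ∀ x ∈ s, ∀ y ∈ s, ‖φ x - φ y - (L x - L y)‖ ≤ δ * K * dist (L x) (L y) := by
    intro x hx y hy
    have := hφ x hx y hy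
    rw [map_sub] at this
    refine this.trans ?_
    rw [mul_assoc, ← dist_eq_norm]
    exact mul_le_mul_of_nonneg_left (hanti x y) δ.2
  rw [← himg]
  constructor
  · refine (euclideanHausdorffMeasure_image_le_of_edist_le (a := L) (b := φ) (C := 1 + δ * K) d
      ?_).trans (mul_le_mul_left ?_ _)
    · intro x hx y hy
      rw [edist_nndist, edist_nndist]
      norm_cast
      rw [← NNReal.coe_le_coe]
      push_cast
      have := happ x hx y hy
      rw [dist_eq_norm] at *
      have := norm_le_norm_add_norm_sub' (φ x - φ y) (L x - L y)
      rw [dist_eq_norm]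
      linarith
    · rw [← ENNReal.coe_pow, ENNReal.coe_le_coe, ← NNReal.coe_le_coe]
      push_cast
      exact hδ1.le
  · refine (euclideanHausdorffMeasure_image_le_of_edist_le (a := φ) (b := L)
      (C := (1 - δ * K)⁻¹) d ?_).trans (mul_le_mul_left ?_ _)
    · intro x hx y hy
      rw [edist_nndist, edist_nndist]
      norm_cast
      rw [← NNReal.coe_le_coe]
      have hle : δ * K ≤ 1 := by
        rw [← NNReal.coe_le_coe]; push_cast; linarith
      push_cast [NNReal.coe_sub hle]
      rw [inv_mul_eq_div, le_div_iff₀ hδ3]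
      have := happ x hx y hy
      have := norm_le_norm_add_norm_sub (φ x - φ y) (L x - L y)
      rw [dist_eq_norm] at *
      rw [dist_eq_norm]
      nlinarith
    · rw [← ENNReal.coe_pow, ENNReal.coe_le_coe, ← NNReal.coe_le_coe]
      have hle : δ * K ≤ 1 := by
        rw [← NNReal.coe_le_coe]; push_cast; linarith
      push_cast [NNReal.coe_sub hle]
      exact hδ2.le

variable [CompleteSpace F]

/-- The area formula for sets: the `d`-dimensional measure of the image of an injective immersion
of a `d`-dimensional space is the integral of the norm determinant of its derivative. -/
theorem measure_image_eq_lintegral_normDet {φ : E → F} {φ' : E → E →L[ℝ] F} {s : Set E}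
    (hs : MeasurableSet s) (hφ : ∀ x ∈ s, HasStrictFDerivAt φ (φ' x) x)
    (hcont : ContinuousOn φ' s) (hinj' : ∀ x ∈ s, Function.Injective (φ' x)) (hinj : InjOn φ s) :
    μHE[finrank ℝ E] (φ '' s) = ∫⁻ x in s, ENNReal.ofReal (φ' x).normDet := by
  have : CompleteSpace E := FiniteDimensional.complete ℝ E
  have hφc : ContinuousOn φ s := fun x hx => (hφ x hx).continuousAt.continuousWithinAt
  have hJc : ContinuousOn (fun x => (φ' x).normDet) s := continuous_normDet.comp_continuousOn hcont
  -- up to two factors `η`, one from comparing `φ` with its derivative and one from the variation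
  -- of the derivative, the formula holds locally, hence globally by a countable partition
  have key : ∀ η : ℝ≥0, 1 < η →
      μHE[finrank ℝ E] (φ '' s) ≤ η * (η * ∫⁻ x in s, ENNReal.ofReal (φ' x).normDet) ∧
      (∫⁻ x in s, ENNReal.ofReal (φ' x).normDet) ≤ η * (η * μHE[finrank ℝ E] (φ '' s)) := by
    intro η hη
    have hη1 : (1 : ℝ) < η := by exact_mod_cast hη
    have hη0 : (0 : ℝ) < η := by positivity
    have hloc : ∀ x ∈ s, ∃ U : Set E, IsOpen U ∧ x ∈ U ∧ ∀ t ⊆ U ∩ s, MeasurableSet t →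
        μHE[finrank ℝ E] (φ '' t) ≤ η * (η * ∫⁻ x in t, ENNReal.ofReal (φ' x).normDet) ∧
        (∫⁻ x in t, ENNReal.ofReal (φ' x).normDet) ≤ η * (η * μHE[finrank ℝ E] (φ '' t)) := by
      intro x hx
      obtain ⟨δ, hδ, H⟩ := exists_measure_image_bounds_of_approximatesLinearOn (φ' x)
        (hinj' x hx) hη
      obtain ⟨V, hV, hVapp⟩ := (hφ x hx).approximates_deriv_on_nhds (Or.inr hδ)
      have hpos : 0 < (φ' x).normDet := by
        refine lt_of_le_of_ne (LinearMap.normDet_nonneg _) (Ne.symm ?_)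
        exact ((LinearMap.normDet_ne_zero_tfae _).out 0 4).2 (hinj' x hx)
      have hr1 : ∀ᶠ y in 𝓝[s] x, (φ' y).normDet < η * (φ' x).normDet :=
        (hJc x hx).eventually_lt_const (by nlinarith)
      have hr2 : ∀ᶠ y in 𝓝[s] x, (φ' x).normDet / η < (φ' y).normDet :=
        (hJc x hx).eventually_const_lt (by rw [div_lt_iff₀ hη0]; nlinarith)
      rw [eventually_nhdsWithin_iff] at hr1 hr2
      obtain ⟨U, hU, hUo, hxU⟩ := mem_nhds_iff.1
        ((hr1.and hr2).and (show ∀ᶠ y in 𝓝 x, y ∈ V from hV))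
      refine ⟨U, hUo, hxU, fun t ht htm => ?_⟩
      have happ : ApproximatesLinearOn φ (φ' x) t δ :=
        hVapp.mono_set fun y hy => (hU (ht hy).1).2
      obtain ⟨hle, hge⟩ := H φ t happ
      have hconst : ENNReal.ofReal (φ' x).normDet * volume t
          = ∫⁻ _ in t, ENNReal.ofReal (φ' x).normDet := by
        rw [setLIntegral_const]
      constructor
      · refine hle.trans (mul_le_mul_right ?_ _)
        rw [hconst, ← lintegral_const_mul' _ _ ENNReal.coe_ne_top]
        refine setLIntegral_mono' htm fun y hy => ?_
        rw [← ENNReal.ofReal_coe_nnreal, ← ENNReal.ofReal_mul hη0.le]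
        refine ENNReal.ofReal_le_ofReal ?_
        have := (hU (ht hy).1).1.2 (ht hy).2
        rw [div_lt_iff₀ hη0] at this
        linarith
      · calc (∫⁻ x in t, ENNReal.ofReal (φ' x).normDet)
            ≤ ∫⁻ _ in t, η * ENNReal.ofReal (φ' x).normDet := by
              refine setLIntegral_mono' htm fun y hy => ?_
              rw [← ENNReal.ofReal_coe_nnreal, ← ENNReal.ofReal_mul hη0.le]
              exact ENNReal.ofReal_le_ofReal ((hU (ht hy).1).1.1 (ht hy).2).le
          _ = η * (ENNReal.ofReal (φ' x).normDet * volume t) := by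
              rw [lintegral_const_mul' _ _ ENNReal.coe_ne_top, hconst]
          _ ≤ _ := mul_le_mul_right hge _
    rcases s.eq_empty_or_nonempty with rfl | ⟨x₀, hx₀⟩
    · simp
    choose! U hUo hxU hUH using hloc
    obtain ⟨T, hTs, hTc, hsT⟩ := TopologicalSpace.countable_cover_nhdsWithin (f := U) (s := s)
      fun x hx => mem_nhdsWithin_of_mem_nhds ((hUo x hx).mem_nhds (hxU x hx))
    have hTne : T.Nonempty := by
      obtain ⟨i, hi, -⟩ := mem_iUnion₂.1 (hsT hx₀)
      exact ⟨i, hi⟩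
    obtain ⟨p, rfl⟩ := hTc.exists_eq_range hTne
    have hps : ∀ m, p m ∈ s := fun m => hTs ⟨m, rfl⟩
    set t : ℕ → Set E := fun m => disjointed (fun m => U (p m)) m ∩ s with ht
    have htm : ∀ m, MeasurableSet (t m) := fun m =>
      (MeasurableSet.disjointed (fun m => (hUo _ (hps m)).measurableSet) m).inter hs
    have htU : ∀ m, t m ⊆ U (p m) ∩ s := fun m =>
      inter_subset_inter_left _ (disjointed_subset _ _)
    have hts : ∀ m, t m ⊆ s := fun m => inter_subset_right
    have hsU : s = ⋃ m, t m := by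
      rw [ht, ← iUnion_inter, iUnion_disjointed, eq_comm, inter_eq_right]
      simpa using hsT
    have hdisj : Pairwise (Function.onFun Disjoint t) := fun i j hij =>
      (disjoint_disjointed (fun m => U (p m)) hij).mono inter_subset_left inter_subset_left
    have hR : ∫⁻ x in s, ENNReal.ofReal (φ' x).normDet
        = ∑' m, ∫⁻ x in t m, ENNReal.ofReal (φ' x).normDet := by
      conv_lhs => rw [hsU]
      exact lintegral_iUnion htm hdisj _
    have hLm : μHE[finrank ℝ E] (φ '' s) = ∑' m, μHE[finrank ℝ E] (φ '' t m) := by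
      conv_lhs => rw [hsU, image_iUnion]
      refine measure_iUnion (fun i j hij => ?_) fun m =>
        (htm m).image_of_continuousOn_injOn (hφc.mono (hts m)) (hinj.mono (hts m))
      exact (hinj.image_inter (hts i) (hts j)).symm.trans
        (by rw [(hdisj hij).inter_eq, image_empty]) |> disjoint_iff_inter_eq_empty.2
    rw [hR, hLm]
    simp only [← ENNReal.tsum_mul_left]
    exact ⟨ENNReal.tsum_le_tsum fun m => (hUH _ (hps m) _ (htU m) (htm m)).1,
      ENNReal.tsum_le_tsum fun m => (hUH _ (hps m) _ (htU m) (htm m)).2⟩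
  have lim : ∀ a b : ℝ≥0∞, (∀ η : ℝ≥0, 1 < η → a ≤ η * (η * b)) → a ≤ b := by
    intro a b h
    have ht : Tendsto (fun η : ℝ≥0 => (η : ℝ≥0∞) * (η * b)) (𝓝[>] 1) (𝓝 (1 * (1 * b))) := by
      have h1 : Tendsto (fun η : ℝ≥0 => (η : ℝ≥0∞)) (𝓝[>] 1) (𝓝 1) :=
        (ENNReal.continuous_coe.tendsto 1).mono_left nhdsWithin_le_nhds
      refine ENNReal.Tendsto.mul h1 (Or.inl one_ne_zero) ?_ (Or.inr ENNReal.one_ne_top)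
      exact ENNReal.Tendsto.mul_const h1 (Or.inl one_ne_zero)
    rw [one_mul, one_mul] at ht
    exact ge_of_tendsto ht (eventually_nhdsWithin_of_forall h)
  exact le_antisymm (lim _ _ fun η hη => (key η hη).1) (lim _ _ fun η hη => (key η hη).2)

/-- The area formula for functions. -/
theorem lintegral_image_eq_lintegral_normDet_mul {φ : E → F} {φ' : E → E →L[ℝ] F} {s : Set E}
    (hs : MeasurableSet s) (hφ : ∀ x, HasStrictFDerivAt φ (φ' x) x)
    (hcont : Continuous φ') (hinj' : ∀ x ∈ s, Function.Injective (φ' x)) (hinj : InjOn φ s)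
    {g : F → ℝ≥0∞} (hg : Measurable g) :
    ∫⁻ y in φ '' s, g y ∂μHE[finrank ℝ E]
      = ∫⁻ x in s, ENNReal.ofReal (φ' x).normDet * g (φ x) := by
  have hφc : Continuous φ := continuous_iff_continuousAt.2 fun x => (hφ x).continuousAt
  have hJ : Measurable fun x => ENNReal.ofReal (φ' x).normDet :=
    (continuous_normDet.comp hcont).measurable.ennreal_ofReal
  have hmap : Measure.map φ ((volume.restrict s).withDensity fun x => ENNReal.ofReal (φ' x).normDet)
      = (μHE[finrank ℝ E]).restrict (φ '' s) := by
    refine Measure.ext fun t ht => ?_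
    have hpre : MeasurableSet (φ ⁻¹' t) := hφc.measurable ht
    rw [Measure.map_apply hφc.measurable ht, withDensity_apply _ hpre, Measure.restrict_apply ht,
      Measure.restrict_restrict hpre, ← image_preimage_inter,
      measure_image_eq_lintegral_normDet (hpre.inter hs) (fun x _ => hφ x) hcont.continuousOn
        (fun x hx => hinj' x hx.2) (hinj.mono inter_subset_right)]
  rw [← hmap, lintegral_map hg hφc.measurable]
  exact lintegral_withDensity_eq_lintegral_mul _ hJ (hg.comp hφc.measurable)

end AreaFormula

/-! ### Volume factors and Fubini for hyperplanes -/

section Hyperplane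

open Module
open scoped RealInnerProductSpace

variable {F : Type*} [NormedAddCommGroup F] [InnerProductSpace ℝ F]

/-- The linear isometry `(t, v) ↦ t • e + v` from `ℝ × e^⊥` onto the whole space, for a unit
vector `e`. -/
noncomputable def lineProdOrthogonal (e : F) (he : ‖e‖ = 1) :
    WithLp 2 (ℝ × (ℝ ∙ e)ᗮ) ≃ₗᵢ[ℝ] F :=
  (LinearIsometryEquiv.withLpProdCongr 2 (LinearIsometryEquiv.toSpanUnitSingleton e he)
    (LinearIsometryEquiv.refl ℝ _)).trans (ℝ ∙ e).orthogonalDecomposition.symm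

theorem lineProdOrthogonal_apply (e : F) (he : ‖e‖ = 1) (t : ℝ) (v : (ℝ ∙ e)ᗮ) :
    lineProdOrthogonal e he (WithLp.toLp 2 (t, v)) = t • e + v := by
  simp [lineProdOrthogonal]

theorem inner_eq_zero_of_mem_orthogonal_span {e : F} (v : (ℝ ∙ e)ᗮ) : ⟪e, (v : F)⟫ = 0 :=
  Submodule.mem_orthogonal_singleton_iff_inner_right.1 v.2

variable [FiniteDimensional ℝ F]

theorem finrank_orthogonal_span_of_norm_eq_one {e : F} (he : ‖e‖ = 1) :
    finrank ℝ (ℝ ∙ e)ᗮ = finrank ℝ F - 1 := by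
  have h1 := (ℝ ∙ e).finrank_add_finrank_orthogonal
  rw [finrank_span_singleton (norm_ne_zero_iff.1 (by rw [he]; exact one_ne_zero))] at h1
  omega

/-- The volume factor of an invertible linear map `A` restricted to the hyperplane `e^⊥`. The vector
`(A⁻¹)† e` is normal to the image hyperplane, and its length compensates for the change of scale of
`A` in the normal direction. -/
theorem normDet_comp_subtype_orthogonal (A : F ≃L[ℝ] F) {e : F} (he : ‖e‖ = 1) :
    ((A : F →ₗ[ℝ] F) ∘ₗ (ℝ ∙ e)ᗮ.subtype).normDet
      = |LinearMap.det (A : F →ₗ[ℝ] F)| *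
        ‖ContinuousLinearMap.adjoint (A.symm : F →L[ℝ] F) e‖ := by
  set w : F := ContinuousLinearMap.adjoint (A.symm : F →L[ℝ] F) e with hw
  have hwA : ∀ x, ⟪w, A x⟫ = ⟪e, x⟫ := by
    intro x
    rw [hw, ContinuousLinearMap.adjoint_inner_left]
    simp
  have hee : ⟪e, e⟫ = 1 := by rw [real_inner_self_eq_norm_sq, he, one_pow]
  have hw0 : w ≠ 0 := by
    intro h0
    have := hwA e
    rw [h0, inner_zero_left, hee] at this
    exact zero_ne_one this
  have hw0' : ‖w‖ ≠ 0 := norm_ne_zero_iff.2 hw0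
  set n : F := ‖w‖⁻¹ • w with hn
  have hnn : ⟪n, n⟫ = 1 := by
    rw [real_inner_self_eq_norm_sq, hn, norm_smul, norm_inv, norm_norm, inv_mul_cancel₀ hw0',
      one_pow]
  have hnA : ∀ v : (ℝ ∙ e)ᗮ, ⟪n, A v⟫ = 0 := by
    intro v
    rw [hn, real_inner_smul_left, hwA, inner_eq_zero_of_mem_orthogonal_span, mul_zero]
  have heA : ⟪e, A.symm n⟫ = ‖w‖ := by
    rw [← hwA, A.apply_symm_apply, hn, real_inner_smul_right, real_inner_self_eq_norm_sq]
    field_simp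
  -- `T` fixes `e^⊥` and sends `e` to `A⁻¹ n`, so `A ∘ T` is the restriction of `A` to `e^⊥`
  -- extended by the unit normal `n` of its range
  set T : F →ₗ[ℝ] F := LinearMap.transvection (innerₗ F e) (A.symm n - e) with hT
  have hTdet : LinearMap.det T = ‖w‖ := by
    rw [hT, LinearMap.transvection.det, innerₗ_apply_apply, inner_sub_right, heA, hee]
    ring
  have hTe : T e = A.symm n := by
    rw [hT, LinearMap.transvection.apply, innerₗ_apply_apply, hee, one_smul]
    abel
  have hTv : ∀ v : (ℝ ∙ e)ᗮ, T v = v := by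
    intro v
    rw [hT, LinearMap.transvection.apply, innerₗ_apply_apply,
      inner_eq_zero_of_mem_orthogonal_span, zero_smul, add_zero]
  set Q := lineProdOrthogonal e he with hQ
  set b := stdOrthonormalBasis ℝ (ℝ ∙ e)ᗮ
  set B : WithLp 2 (ℝ × (ℝ ∙ e)ᗮ) →ₗ[ℝ] F :=
    ((A : F →ₗ[ℝ] F) ∘ₗ T) ∘ₗ (Q.toLinearEquiv : _ →ₗ[ℝ] F) with hB
  have hQ1 : (Q.toLinearEquiv : WithLp 2 (ℝ × (ℝ ∙ e)ᗮ) →ₗ[ℝ] F).normDet = 1 :=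
    Q.toLinearIsometry.normDet_eq_one
  have hBdet : B.normDet = |LinearMap.det (A : F →ₗ[ℝ] F)| * ‖w‖ := by
    rw [hB, LinearMap.normDet_comp_of_finrank_eq _ _ Q.toLinearEquiv.finrank_eq,
      LinearMap.normDet_eq_abs_det, LinearMap.det_comp, hTdet, abs_mul, abs_norm, hQ1, mul_one]
  rw [← hBdet, ← sq_eq_sq₀ (LinearMap.normDet_nonneg _) (LinearMap.normDet_nonneg _)]
  have h1 := LinearMap.normDet_sq_eq_det_gram ((A : F →ₗ[ℝ] F) ∘ₗ (ℝ ∙ e)ᗮ.subtype) b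
  have h2 := LinearMap.normDet_sq_eq_det_gram B ((OrthonormalBasis.singleton Unit ℝ).prod b)
  have hBapp : ∀ t v, B (WithLp.toLp 2 (t, v)) = A (T (t • e + v)) := fun t v =>
    congrArg (fun x => A (T x)) (lineProdOrthogonal_apply e he t v)
  have hBl : ∀ u : Unit, B ((OrthonormalBasis.singleton Unit ℝ).prod b (Sum.inl u)) = n := by
    intro u
    have h : (OrthonormalBasis.singleton Unit ℝ).prod b (Sum.inl u) = WithLp.toLp 2 (1, 0) := by
      simp [OrthonormalBasis.prod_apply]
    rw [h, hBapp, one_smul, Submodule.coe_zero, add_zero, hTe, A.apply_symm_apply]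
  have hBr : ∀ i, B ((OrthonormalBasis.singleton Unit ℝ).prod b (Sum.inr i)) = A (b i) := by
    intro i
    have h : (OrthonormalBasis.singleton Unit ℝ).prod b (Sum.inr i) = WithLp.toLp 2 (0, b i) := by
      simp [OrthonormalBasis.prod_apply]
    rw [h, hBapp, zero_smul, zero_add, hTv]
  have hgram : Matrix.gram ℝ (fun i => B ((OrthonormalBasis.singleton Unit ℝ).prod b i))
      = Matrix.fromBlocks 1 0 0
        (Matrix.gram ℝ fun i => ((A : F →ₗ[ℝ] F) ∘ₗ (ℝ ∙ e)ᗮ.subtype) (b i)) := by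
    ext i j
    rcases i with i | i <;> rcases j with j | j
    · rw [Matrix.gram_apply, hBl, hnn]
      simp
    · rw [Matrix.gram_apply, hBl, hBr, hnA]
      rfl
    · rw [Matrix.gram_apply, hBl, hBr, real_inner_comm, hnA]
      rfl
    · simp only [Matrix.gram_apply, hBr]
      rfl
  rw [hgram, Matrix.det_fromBlocks_zero₂₁, Matrix.det_one, one_mul, ← h1] at h2
  exact_mod_cast h2.symm

variable [MeasurableSpace F] [BorelSpace F]

theorem measurePreserving_smul_add_orthogonal {e : F} (he : ‖e‖ = 1) :
    MeasurePreserving (fun p : ℝ × (ℝ ∙ e)ᗮ => p.1 • e + (p.2 : F)) := by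
  have h := (lineProdOrthogonal e he).measurePreserving.comp
    (WithLp.volume_preserving_toLp ℝ (ℝ ∙ e)ᗮ)
  convert h using 1
  ext p
  exact (lineProdOrthogonal_apply e he p.1 p.2).symm

open scoped ENNReal in
theorem lintegral_eq_lintegral_lintegral_orthogonal {e : F} (he : ‖e‖ = 1) {g : F → ℝ≥0∞}
    (hg : Measurable g) :
    ∫⁻ x, g x = ∫⁻ t : ℝ, ∫⁻ v : (ℝ ∙ e)ᗮ, g (t • e + v) := by
  have h := measurePreserving_smul_add_orthogonal he
  rw [← h.lintegral_comp hg, Measure.volume_eq_prod, lintegral_prod]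
  exact (hg.comp h.measurable).aemeasurable

end Hyperplane

/-! ### Monomials in logarithmic coordinates -/

section LogCoordinates

open Module Set
open scoped RealInnerProductSpace ENNReal

variable {n : ℕ}

/-- The coordinatewise exponential `ζ ↦ (exp ζ₁, …, exp ζₙ)`. -/
noncomputable def coordExp (ζ : EuclideanSpace ℂ (Fin n)) : EuclideanSpace ℂ (Fin n) :=
  WithLp.toLp 2 fun j => Complex.exp (ζ j)

/-- The logarithmic coordinates of the points of the unit polydisc with no vanishing coordinate:
negative real parts, and imaginary parts in `(-π, π]`, so that the exponential is injective. -/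
def logStrip (n : ℕ) : Set (EuclideanSpace ℂ (Fin n)) :=
  {ζ | ∀ j, (ζ j).re < 0 ∧ (ζ j).im ∈ Ioc (-Real.pi) Real.pi}

/-- The exponents of a monomial as a (real) vector of `ℂⁿ`. -/
noncomputable def exponentVec (A : Fin n → ℕ) : EuclideanSpace ℂ (Fin n) :=
  WithLp.toLp 2 fun j => (A j : ℂ)

/-- Coordinatewise multiplication by `w`, as a real linear map that depends linearly on `w`. It is
the derivative of `coordExp` for `w = coordExp ζ`. -/
noncomputable def coordMul :
    EuclideanSpace ℂ (Fin n) →ₗ[ℝ] EuclideanSpace ℂ (Fin n) →L[ℝ] EuclideanSpace ℂ (Fin n) :=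
  (LinearMap.toContinuousLinearMap (𝕜 := ℝ)).toLinearMap ∘ₗ
    LinearMap.mk₂ ℝ (fun w x => WithLp.toLp 2 fun j => w j * x j)
      (fun w w' x => by ext j; simp [add_mul])
      (fun c w x => by ext j; simp [mul_assoc])
      (fun w x x' => by ext j; simp [mul_add])
      (fun c w x => by ext j; simp [mul_left_comm])

theorem coordMul_apply (w x : EuclideanSpace ℂ (Fin n)) (j : Fin n) :
    coordMul w x j = w j * x j := rfl

theorem continuous_coordMul :
    Continuous (coordMul : EuclideanSpace ℂ (Fin n) → _) :=
  LinearMap.continuous_of_finiteDimensional coordMul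

theorem det_coordMul (w : EuclideanSpace ℂ (Fin n)) :
    LinearMap.det (coordMul w : EuclideanSpace ℂ (Fin n) →ₗ[ℝ] _) = ∏ j, ‖w j‖ ^ 2 := by
  let L : EuclideanSpace ℂ (Fin n) →ₗ[ℂ] EuclideanSpace ℂ (Fin n) :=
    { toFun := fun x => WithLp.toLp 2 fun j => w j * x j
      map_add' := fun x y => by ext j; simp [mul_add]
      map_smul' := fun c x => by ext j; simp [mul_left_comm] }
  have hL : (coordMul w : EuclideanSpace ℂ (Fin n) →ₗ[ℝ] _) = L.restrictScalars ℝ := rfl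
  have hdet : LinearMap.det L = ∏ j, w j := by
    rw [← LinearMap.det_toMatrix (EuclideanSpace.basisFun (Fin n) ℂ).toBasis]
    have : LinearMap.toMatrix (EuclideanSpace.basisFun (Fin n) ℂ).toBasis
        (EuclideanSpace.basisFun (Fin n) ℂ).toBasis L = Matrix.diagonal fun j => w j := by
      ext i j
      simp [LinearMap.toMatrix_apply, L, Matrix.diagonal_apply]
    rw [this, Matrix.det_diagonal]
  rw [hL, LinearMap.det_restrictScalars, hdet, map_prod]
  simp [Algebra.norm_complex_apply, Complex.normSq_eq_norm_sq]

/-- Coordinatewise multiplication by a vector without vanishing coordinates is invertible. -/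
noncomputable def coordMulEquiv (w : EuclideanSpace ℂ (Fin n)) (hw : ∀ j, w j ≠ 0) :
    EuclideanSpace ℂ (Fin n) ≃L[ℝ] EuclideanSpace ℂ (Fin n) :=
  ContinuousLinearEquiv.equivOfInverse (coordMul w) (coordMul (WithLp.toLp 2 fun j => (w j)⁻¹))
    (fun x => by ext j; simp [coordMul_apply, hw j])
    (fun x => by ext j; simp [coordMul_apply, hw j])

theorem real_inner_eq_sum (x y : EuclideanSpace ℂ (Fin n)) :
    ⟪x, y⟫ = ∑ j, ((starRingEnd ℂ (x j)) * y j).re := by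
  rw [PiLp.inner_apply]
  refine Finset.sum_congr rfl fun j _ => ?_
  rw [Complex.inner, mul_comm]

theorem adjoint_coordMul (w : EuclideanSpace ℂ (Fin n)) :
    ContinuousLinearMap.adjoint (coordMul w)
      = coordMul (WithLp.toLp 2 fun j => (starRingEnd ℂ) (w j)) := by
  symm
  rw [ContinuousLinearMap.eq_adjoint_iff]
  intro x y
  simp only [real_inner_eq_sum, coordMul_apply, map_mul, Complex.conj_conj]
  refine Finset.sum_congr rfl fun j _ => ?_
  ring_nf

theorem hasStrictFDerivAt_coordExp (ζ : EuclideanSpace ℂ (Fin n)) :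
    HasStrictFDerivAt coordExp (coordMul (coordExp ζ)) ζ := by
  rw [hasStrictFDerivAt_piLp]
  intro j
  have h1 : HasStrictFDerivAt (fun x : EuclideanSpace ℂ (Fin n) => x j)
      (PiLp.proj 2 (fun _ : Fin n => ℂ) j : EuclideanSpace ℂ (Fin n) →L[ℝ] ℂ) ζ :=
    (PiLp.proj 2 (fun _ : Fin n => ℂ) j : EuclideanSpace ℂ (Fin n) →L[ℝ] ℂ).hasStrictFDerivAt
  have h2 := ((Complex.hasStrictDerivAt_exp (ζ j)).hasStrictFDerivAt.restrictScalars ℝ).comp ζ h1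
  refine h2.congr_fderiv ?_
  ext x
  simp [coordMul_apply, coordExp, mul_comm]

theorem continuous_coordExp : Continuous (coordExp (n := n)) :=
  continuous_iff_continuousAt.2 fun ζ => (hasStrictFDerivAt_coordExp ζ).continuousAt

theorem coordExp_apply (ζ : EuclideanSpace ℂ (Fin n)) (j : Fin n) :
    coordExp ζ j = Complex.exp (ζ j) := rfl

theorem coordExp_ne_zero (ζ : EuclideanSpace ℂ (Fin n)) (j : Fin n) : coordExp ζ j ≠ 0 :=
  Complex.exp_ne_zero _

theorem injOn_coordExp : InjOn coordExp (logStrip n) := by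
  intro x hx y hy h
  ext j
  have := congrArg (fun z : EuclideanSpace ℂ (Fin n) => z j) h
  exact Complex.exp_inj_of_neg_pi_lt_of_le_pi (hx j).2.1 (hx j).2.2 (hy j).2.1 (hy j).2.2 this

theorem image_coordExp_logStrip :
    coordExp '' logStrip n = {z | z ∈ unitPolydisc n ∧ ∀ j, z j ≠ 0} := by
  ext z
  constructor
  · rintro ⟨ζ, hζ, rfl⟩
    refine ⟨fun j => ?_, coordExp_ne_zero ζ⟩
    rw [coordExp_apply, Complex.norm_exp, Real.exp_lt_one_iff]
    exact (hζ j).1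
  · rintro ⟨hz, hz0⟩
    refine ⟨WithLp.toLp 2 fun j => Complex.log (z j), fun j => ⟨?_, ?_, ?_⟩, ?_⟩
    · simp only [Complex.log_re]
      exact Real.log_neg (norm_pos_iff.2 (hz0 j)) (hz j)
    · exact Complex.neg_pi_lt_log_im _
    · exact Complex.log_im_le_pi _
    · ext j
      rw [coordExp_apply]
      exact Complex.exp_log (hz0 j)

theorem continuous_coord (j : Fin n) : Continuous fun ζ : EuclideanSpace ℂ (Fin n) => ζ j :=
  (PiLp.proj 2 (fun _ : Fin n => ℂ) j : _ →L[ℝ] ℂ).continuous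

theorem measurableSet_logStrip : MeasurableSet (logStrip n) := by
  have : logStrip n = ⋂ j, ({ζ | (ζ j).re < 0} ∩ {ζ | (ζ j).im ∈ Ioc (-Real.pi) Real.pi}) := by
    ext ζ; simp [logStrip]
  rw [this]
  refine MeasurableSet.iInter fun j => MeasurableSet.inter ?_ ?_
  · exact (isOpen_lt (Complex.continuous_re.comp (continuous_coord j))
      continuous_const).measurableSet
  · exact (Complex.continuous_im.comp (continuous_coord j)).measurable measurableSet_Ioc

theorem norm_monomialFun_coordExp (A : Fin n → ℕ) (ζ : EuclideanSpace ℂ (Fin n)) :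
    ‖monomialFun A (coordExp ζ)‖ = Real.exp ⟪exponentVec A, ζ⟫ := by
  rw [monomialFun, norm_prod, real_inner_eq_sum, Real.exp_sum]
  refine Finset.prod_congr rfl fun j _ => ?_
  rw [norm_pow, coordExp_apply, Complex.norm_exp, ← Real.exp_nat_mul]
  simp [exponentVec]

theorem complexGrad_monomialFun (A : Fin n → ℕ) (z : EuclideanSpace ℂ (Fin n)) (i : Fin n) :
    complexGrad (monomialFun A) z i
      = (∏ j ∈ Finset.univ.erase i, z j ^ A j) * (A i * z i ^ (A i - 1)) := by
  have hj : ∀ j, HasFDerivAt (fun x : EuclideanSpace ℂ (Fin n) => x j ^ A j)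
      ((A j * z j ^ (A j - 1)) • (PiLp.proj 2 (fun _ : Fin n => ℂ) j : _ →L[ℂ] ℂ)) z := by
    intro j
    exact (hasDerivAt_pow (A j) (z j)).comp_hasFDerivAt z
      (PiLp.proj 2 (fun _ : Fin n => ℂ) j : _ →L[ℂ] ℂ).hasFDerivAt
  have h := HasFDerivAt.finsetProd (u := Finset.univ) fun j _ => hj j
  have h' : fderiv ℂ (monomialFun A) z = _ := h.fderiv
  simp only [complexGrad, h']
  rw [_root_.sum_apply, Finset.sum_eq_single i]
  · simp
  · intro j _ hji
    simp [hji]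
  · simp

theorem continuous_complexGrad_monomialFun (A : Fin n → ℕ) :
    Continuous (complexGrad (monomialFun A)) := by
  have h : complexGrad (monomialFun A) = fun z : EuclideanSpace ℂ (Fin n) => WithLp.toLp 2 fun i =>
      (∏ j ∈ Finset.univ.erase i, z j ^ A j) * (A i * z i ^ (A i - 1)) := by
    funext z
    ext i
    exact complexGrad_monomialFun A z i
  rw [h]
  refine (PiLp.continuous_toLp 2 _).comp (continuous_pi fun i => ?_)
  have := continuous_coord (n := n)
  fun_prop

theorem complexGrad_monomialFun_of_ne_zero (A : Fin n → ℕ) {z : EuclideanSpace ℂ (Fin n)}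
    (hz : ∀ j, z j ≠ 0) :
    complexGrad (monomialFun A) z
      = monomialFun A z • (WithLp.toLp 2 fun i => (A i : ℂ) / z i) := by
  ext i
  rw [complexGrad_monomialFun, PiLp.smul_apply, monomialFun,
    ← Finset.mul_prod_erase Finset.univ _ (Finset.mem_univ i), smul_eq_mul]
  have := hz i
  rcases Nat.eq_zero_or_pos (A i) with h0 | h0
  · simp [h0]
  · have : z i ^ A i = z i ^ (A i - 1) * z i := by rw [← pow_succ, Nat.sub_add_cancel h0]
    rw [this]
    field_simp

/-- The weight `∑ i, k i ^ 2 * ∏ j ≠ i, ‖z j‖ ^ 2` at `z = coordExp ζ`. It is the squared length of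
the logarithmic gradient of the monomial times the Jacobian of `coordExp`. -/
noncomputable def gradWeight (A : Fin n → ℕ) (ζ : EuclideanSpace ℂ (Fin n)) : ℝ :=
  ∑ i, (A i : ℝ) ^ 2 * ∏ j ∈ Finset.univ.erase i, Real.exp (2 * (ζ j).re)

theorem norm_sq_coordExp (ζ : EuclideanSpace ℂ (Fin n)) (j : Fin n) :
    ‖coordExp ζ j‖ ^ 2 = Real.exp (2 * (ζ j).re) := by
  rw [coordExp_apply, Complex.norm_exp, ← Real.exp_nat_mul, Nat.cast_ofNat]

theorem prod_norm_sq_mul_norm_complexGrad_sq (A : Fin n → ℕ) (ζ : EuclideanSpace ℂ (Fin n)) :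
    (∏ j, ‖coordExp ζ j‖ ^ 2) * ‖complexGrad (monomialFun A) (coordExp ζ)‖ ^ 2
      = ‖monomialFun A (coordExp ζ)‖ ^ 2 * gradWeight A ζ := by
  rw [complexGrad_monomialFun_of_ne_zero A (coordExp_ne_zero ζ), norm_smul, mul_pow,
    mul_left_comm, EuclideanSpace.norm_sq_eq, gradWeight, Finset.mul_sum]
  congr 1
  refine Finset.sum_congr rfl fun i _ => ?_
  rw [← Finset.mul_prod_erase Finset.univ _ (Finset.mem_univ i)]
  have h0 : ‖coordExp ζ i‖ ≠ 0 := norm_ne_zero_iff.2 (coordExp_ne_zero ζ i)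
  simp only [norm_div, Complex.norm_natCast, ← norm_sq_coordExp]
  field_simp

theorem norm_exponentVec_pos {A : Fin n → ℕ} (hA : ∃ j, A j ≠ 0) : 0 < ‖exponentVec A‖ := by
  obtain ⟨j, hj⟩ := hA
  rw [norm_pos_iff]
  intro h
  have := congrArg (fun z : EuclideanSpace ℂ (Fin n) => z j) h
  simp [exponentVec] at this
  exact hj this

/-- The unit vector in the direction of the exponent vector: the common normal of the level
hyperplanes of the monomial in logarithmic coordinates. -/
noncomputable def exponentDir (A : Fin n → ℕ) : EuclideanSpace ℂ (Fin n) :=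
  ‖exponentVec A‖⁻¹ • exponentVec A

theorem norm_exponentDir {A : Fin n → ℕ} (hA : ∃ j, A j ≠ 0) : ‖exponentDir A‖ = 1 := by
  rw [exponentDir, norm_smul, norm_inv, norm_norm, inv_mul_cancel₀ (norm_exponentVec_pos hA).ne']

theorem inner_exponentVec_smul_add {A : Fin n → ℕ} (hA : ∃ j, A j ≠ 0) (t : ℝ)
    (v : (ℝ ∙ exponentDir A)ᗮ) :
    ⟪exponentVec A, t • exponentDir A + v⟫ = t * ‖exponentVec A‖ := by
  have hk := (norm_exponentVec_pos hA).ne'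
  have : exponentVec A = ‖exponentVec A‖ • exponentDir A := by
    rw [exponentDir, smul_smul, mul_inv_cancel₀ hk, one_smul]
  conv_lhs => rw [this]
  rw [real_inner_smul_left, inner_add_right, inner_eq_zero_of_mem_orthogonal_span,
    real_inner_smul_right, real_inner_self_eq_norm_sq, norm_exponentDir hA]
  ring

theorem normDet_coordMul_comp_subtype {A : Fin n → ℕ} (hA : ∃ j, A j ≠ 0)
    {z : EuclideanSpace ℂ (Fin n)} (hz : ∀ j, z j ≠ 0) :
    ((coordMul z : EuclideanSpace ℂ (Fin n) →ₗ[ℝ] EuclideanSpace ℂ (Fin n)) ∘ₗ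
        (ℝ ∙ exponentDir A)ᗮ.subtype).normDet
      = (∏ j, ‖z j‖ ^ 2) * ‖complexGrad (monomialFun A) z‖ /
        (‖exponentVec A‖ * ‖monomialFun A z‖) := by
  have h : ((coordMul z : EuclideanSpace ℂ (Fin n) →ₗ[ℝ] EuclideanSpace ℂ (Fin n)) ∘ₗ
        (ℝ ∙ exponentDir A)ᗮ.subtype).normDet
      = |LinearMap.det (coordMul z : EuclideanSpace ℂ (Fin n) →ₗ[ℝ] EuclideanSpace ℂ (Fin n))| *
        ‖ContinuousLinearMap.adjoint (coordMul (WithLp.toLp 2 fun j => (z j)⁻¹))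
          (exponentDir A)‖ :=
    normDet_comp_subtype_orthogonal (coordMulEquiv z hz) (norm_exponentDir hA)
  have h3 : ‖coordMul (WithLp.toLp 2 fun j => (starRingEnd ℂ) (z j)⁻¹) (exponentVec A)‖
      = ‖(WithLp.toLp 2 fun i => (A i : ℂ) / z i : EuclideanSpace ℂ (Fin n))‖ := by
    rw [EuclideanSpace.norm_eq, EuclideanSpace.norm_eq]
    congr 1
    refine Finset.sum_congr rfl fun j _ => ?_
    simp [coordMul_apply, exponentVec, div_eq_inv_mul]
  have hf : ‖monomialFun A z‖ ≠ 0 :=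
    norm_ne_zero_iff.2 (Finset.prod_ne_zero_iff.2 fun j _ => pow_ne_zero _ (hz j))
  rw [adjoint_coordMul, det_coordMul, abs_of_nonneg (by positivity)] at h
  rw [h, complexGrad_monomialFun_of_ne_zero A hz, norm_smul, exponentDir, map_smul, norm_smul, h3,
    norm_inv, norm_norm]
  have := (norm_exponentVec_pos hA).ne'
  field_simp

end LogCoordinates

/-! ### Both energies as integrals over slices -/

section EnergyFormulas

open Module Set
open scoped RealInnerProductSpace ENNReal

variable {n : ℕ}

theorem finrank_real_euclideanSpace_complex :
    finrank ℝ (EuclideanSpace ℂ (Fin n)) = 2 * n := by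
  rw [← finrank_mul_finrank ℝ ℂ, Complex.finrank_real_complex, finrank_euclideanSpace_fin]

theorem euclideanHausdorffMeasure_coord_eq_zero {d : ℕ} (hd : 2 * n - 2 < d) (j : Fin n) :
    μHE[d] {z : EuclideanSpace ℂ (Fin n) | z j = 0} = 0 := by
  let P : EuclideanSpace ℂ (Fin n) →ₗ[ℝ] ℂ :=
    ((PiLp.proj 2 (fun _ : Fin n => ℂ) j : EuclideanSpace ℂ (Fin n) →L[ℝ] ℂ) :
      EuclideanSpace ℂ (Fin n) →ₗ[ℝ] ℂ)
  have hsurj : P.range = ⊤ := by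
    rw [LinearMap.range_eq_top]
    intro c
    exact ⟨EuclideanSpace.single j c, by simp [P]⟩
  have hrk := P.finrank_range_add_finrank_ker
  rw [hsurj, finrank_top, Complex.finrank_real_complex, finrank_real_euclideanSpace_complex] at hrk
  have hset : {z : EuclideanSpace ℂ (Fin n) | z j = 0} = (Subtype.val '' (univ : Set P.ker)) := by
    ext z
    simp [P]
  have hlt : (finrank ℝ P.ker : ℝ) < (d : ℝ) := by
    have : finrank ℝ P.ker < d := by omega
    exact_mod_cast this
  rw [hset, isometry_subtype_coe.euclideanHausdorffMeasure_image,
    Measure.euclideanHausdorffMeasure_def, Real.hausdorffMeasure_of_finrank_lt hlt]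
  simp

theorem volume_coord_eq_zero (j : Fin n) :
    volume {z : EuclideanSpace ℂ (Fin n) | z j = 0} = 0 := by
  rw [← InnerProductSpace.euclideanHausdorffMeasure_eq_volume, finrank_real_euclideanSpace_complex]
  have := j.pos
  exact euclideanHausdorffMeasure_coord_eq_zero (by omega) j

theorem ae_eq_inter_coord_ne_zero {μ : Measure (EuclideanSpace ℂ (Fin n))}
    (hμ : ∀ j, μ {z | z j = 0} = 0) (s : Set (EuclideanSpace ℂ (Fin n))) :
    s =ᵐ[μ] (s ∩ {z | ∀ j, z j ≠ 0} : Set _) := by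
  have h : ∀ᵐ z ∂μ, ∀ j, z j ≠ 0 := ae_all_iff.2 fun j => by
    rw [ae_iff]; simpa using hμ j
  exact (inter_ae_eq_left_of_ae_eq_univ (eventuallyEq_univ.2 h)).symm

/-- The integral of `gradWeight A` over the part of the hyperplane `t • e + e^⊥` in `logStrip n`,
with `e = exponentDir A`. -/
noncomputable def sliceMass (A : Fin n → ℕ) (t : ℝ) : ℝ≥0∞ :=
  ∫⁻ v : (ℝ ∙ exponentDir A)ᗮ, (logStrip n).indicator (fun ζ => ENNReal.ofReal (gradWeight A ζ))
    (t • exponentDir A + v)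

theorem continuous_gradWeight (A : Fin n → ℕ) : Continuous (gradWeight A) := by
  unfold gradWeight
  have h : ∀ j : Fin n, Continuous fun ζ : EuclideanSpace ℂ (Fin n) => (ζ j).re := fun j =>
    Complex.continuous_re.comp (continuous_coord j)
  fun_prop

/-- The part of a level set of the monomial without vanishing coordinates is parametrized by a
slice. -/
theorem image_level_slice {A : Fin n → ℕ} (hA : ∃ j, A j ≠ 0) {ε : ℝ} (hε : 0 < ε) :
    (fun v : (ℝ ∙ exponentDir A)ᗮ =>
        coordExp ((Real.log ε / ‖exponentVec A‖) • exponentDir A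
          + (v : EuclideanSpace ℂ (Fin n)))) ''
      {v | (Real.log ε / ‖exponentVec A‖) • exponentDir A
        + (v : EuclideanSpace ℂ (Fin n)) ∈ logStrip n}
    = {z | z ∈ unitPolydisc n ∧ ‖monomialFun A z‖ = ε} ∩ {z | ∀ j, z j ≠ 0} := by
  have hk := (norm_exponentVec_pos hA).ne'
  ext z
  constructor
  · rintro ⟨v, hv, rfl⟩
    have himg := image_coordExp_logStrip.subset (mem_image_of_mem coordExp hv)
    refine ⟨⟨himg.1, ?_⟩, himg.2⟩
    rw [norm_monomialFun_coordExp, inner_exponentVec_smul_add hA, div_mul_cancel₀ _ hk,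
      Real.exp_log hε]
  · rintro ⟨⟨hzU, hzf⟩, hz0⟩
    obtain ⟨ζ, hζ, rfl⟩ := image_coordExp_logStrip.superset ⟨hzU, hz0⟩
    rw [norm_monomialFun_coordExp] at hzf
    have hinner : ⟪exponentVec A, ζ⟫ = Real.log ε := by rw [← hzf, Real.log_exp]
    have hmem : ζ - (Real.log ε / ‖exponentVec A‖) • exponentDir A ∈ (ℝ ∙ exponentDir A)ᗮ := by
      rw [Submodule.mem_orthogonal_singleton_iff_inner_right, inner_sub_right,
        real_inner_smul_right, real_inner_self_eq_norm_sq, norm_exponentDir hA, exponentDir,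
        real_inner_smul_left, hinner]
      field_simp
      ring
    refine ⟨⟨_, hmem⟩, ?_, ?_⟩ <;> simp [hζ]

theorem lintegral_level_eq {A : Fin n → ℕ} (hA : ∃ j, A j ≠ 0) {ε : ℝ} (hε : 0 < ε) :
    ∫⁻ z in {z | z ∈ unitPolydisc n ∧ ‖monomialFun A z‖ = ε},
        ENNReal.ofReal ‖complexGrad (monomialFun A) z‖ ∂μHE[2 * n - 1]
      = ENNReal.ofReal (ε / ‖exponentVec A‖) *
        sliceMass A (Real.log ε / ‖exponentVec A‖) := by
  have hk := norm_exponentVec_pos hA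
  have hn : 0 < n := by
    obtain ⟨j, -⟩ := hA
    exact j.pos
  set t := Real.log ε / ‖exponentVec A‖ with ht
  have htk : t * ‖exponentVec A‖ = Real.log ε := div_mul_cancel₀ _ hk.ne'
  set φ : (ℝ ∙ exponentDir A)ᗮ → EuclideanSpace ℂ (Fin n) :=
    fun v => coordExp (t • exponentDir A + v) with hφ
  set φ' : (ℝ ∙ exponentDir A)ᗮ → (ℝ ∙ exponentDir A)ᗮ →L[ℝ] EuclideanSpace ℂ (Fin n) :=
    fun v => coordMul (φ v) ∘L (ℝ ∙ exponentDir A)ᗮ.subtypeL with hφ'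
  set S : Set (ℝ ∙ exponentDir A)ᗮ :=
    {v | t • exponentDir A + (v : EuclideanSpace ℂ (Fin n)) ∈ logStrip n} with hS
  have hshift : Continuous fun v : (ℝ ∙ exponentDir A)ᗮ =>
      t • exponentDir A + (v : EuclideanSpace ℂ (Fin n)) :=
    continuous_const.add continuous_subtype_val
  have hSm : MeasurableSet S := hshift.measurable measurableSet_logStrip
  have hderiv : ∀ v, HasStrictFDerivAt φ (φ' v) v := fun v =>
    (hasStrictFDerivAt_coordExp _).comp v
      ((ℝ ∙ exponentDir A)ᗮ.subtypeL.hasStrictFDerivAt.const_add (t • exponentDir A))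
  have hcont : Continuous φ' :=
    (continuous_coordMul.comp (continuous_coordExp.comp hshift)).clm_comp continuous_const
  have hinj' : ∀ v ∈ S, Function.Injective (φ' v) := fun v _ =>
    (coordMulEquiv (φ v) (coordExp_ne_zero _)).injective.comp Subtype.val_injective
  have hinj : InjOn φ S := by
    intro v hv w hw h
    exact Subtype.ext (add_left_cancel (injOn_coordExp hv hw h))
  have hrank : finrank ℝ (ℝ ∙ exponentDir A)ᗮ = 2 * n - 1 := by
    rw [finrank_orthogonal_span_of_norm_eq_one (norm_exponentDir hA),
      finrank_real_euclideanSpace_complex]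
  have harea := lintegral_image_eq_lintegral_normDet_mul hSm hderiv hcont hinj' hinj
    (continuous_complexGrad_monomialFun A).norm.measurable.ennreal_ofReal
  rw [hrank, image_level_slice hA hε] at harea
  rw [setLIntegral_congr (ae_eq_inter_coord_ne_zero
    (fun j => euclideanHausdorffMeasure_coord_eq_zero (by omega) j) _), harea, sliceMass,
    ← lintegral_const_mul' _ _ ENNReal.ofReal_ne_top, ← lintegral_indicator hSm]
  refine lintegral_congr fun v => ?_
  by_cases hv : v ∈ S
  · have hv' : t • exponentDir A + (v : EuclideanSpace ℂ (Fin n)) ∈ logStrip n := hv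
    rw [indicator_of_mem hv, indicator_of_mem hv',
      ← ENNReal.ofReal_mul (LinearMap.normDet_nonneg _),
      ← ENNReal.ofReal_mul (by positivity)]
    congr 1
    have hf : ‖monomialFun A (φ v)‖ = ε := by
      rw [hφ, norm_monomialFun_coordExp, inner_exponentVec_smul_add hA, htk, Real.exp_log hε]
    have h1 := normDet_coordMul_comp_subtype hA (z := φ v) (coordExp_ne_zero _)
    have h2 := prod_norm_sq_mul_norm_complexGrad_sq A (t • exponentDir A + v)
    change _ = ‖monomialFun A (φ v)‖ ^ 2 * _ at h2
    change (∏ j, ‖φ v j‖ ^ 2) * ‖complexGrad (monomialFun A) (φ v)‖ ^ 2 = _ at h2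
    change LinearMap.normDet ((coordMul (φ v) :
      EuclideanSpace ℂ (Fin n) →ₗ[ℝ] EuclideanSpace ℂ (Fin n)) ∘ₗ
        (ℝ ∙ exponentDir A)ᗮ.subtype) * _ = _
    rw [hf] at h1 h2
    rw [h1, div_mul_eq_mul_div, mul_assoc, ← sq, h2]
    field_simp
  · have hv' : t • exponentDir A + (v : EuclideanSpace ℂ (Fin n)) ∉ logStrip n := hv
    rw [indicator_of_notMem hv, indicator_of_notMem hv', mul_zero]

theorem lintegral_image_coordExp {s : Set (EuclideanSpace ℂ (Fin n))} (hs : MeasurableSet s)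
    (hsub : s ⊆ logStrip n) (g : EuclideanSpace ℂ (Fin n) → ℝ≥0∞) :
    ∫⁻ z in coordExp '' s, g z
      = ∫⁻ ζ in s, ENNReal.ofReal (∏ j, ‖coordExp ζ j‖ ^ 2) * g (coordExp ζ) := by
  rw [lintegral_image_eq_lintegral_abs_det_fderiv_mul volume hs
    (fun x _ => (hasStrictFDerivAt_coordExp x).hasFDerivAt.hasFDerivWithinAt)
    (injOn_coordExp.mono hsub)]
  refine lintegral_congr fun ζ => ?_
  rw [ContinuousLinearMap.det, det_coordMul, abs_of_nonneg (by positivity)]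

theorem lintegral_sublevel_eq {A : Fin n → ℕ} (hA : ∃ j, A j ≠ 0) {ε : ℝ} (hε : 0 < ε) :
    ∫⁻ z in {z | z ∈ unitPolydisc n ∧ ‖monomialFun A z‖ < ε},
        ENNReal.ofReal (‖complexGrad (monomialFun A) z‖ ^ 2)
      = ∫⁻ t in Iio (Real.log ε / ‖exponentVec A‖),
        ENNReal.ofReal (Real.exp (2 * ‖exponentVec A‖ * t)) * sliceMass A t := by
  have hk := norm_exponentVec_pos hA
  set k := ‖exponentVec A‖
  have hopen : MeasurableSet {ζ : EuclideanSpace ℂ (Fin n) | ⟪exponentVec A, ζ⟫ < Real.log ε} :=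
    (isOpen_lt (by fun_prop) continuous_const).measurableSet
  set s := logStrip n ∩ {ζ | ⟪exponentVec A, ζ⟫ < Real.log ε} with hs
  have hsm : MeasurableSet s := measurableSet_logStrip.inter hopen
  have himg : coordExp '' s
      = {z | z ∈ unitPolydisc n ∧ ‖monomialFun A z‖ < ε} ∩ {z | ∀ j, z j ≠ 0} := by
    have hlt : ∀ ζ, ‖monomialFun A (coordExp ζ)‖ < ε ↔ ⟪exponentVec A, ζ⟫ < Real.log ε := by
      intro ζ
      rw [norm_monomialFun_coordExp, Real.lt_log_iff_exp_lt hε]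
    ext z
    constructor
    · rintro ⟨ζ, ⟨hζ, hζf⟩, rfl⟩
      have := image_coordExp_logStrip.subset (mem_image_of_mem coordExp hζ)
      exact ⟨⟨this.1, (hlt ζ).2 hζf⟩, this.2⟩
    · rintro ⟨⟨hzU, hzf⟩, hz0⟩
      obtain ⟨ζ, hζ, rfl⟩ := image_coordExp_logStrip.superset ⟨hzU, hz0⟩
      exact ⟨ζ, ⟨hζ, (hlt ζ).1 hzf⟩, rfl⟩
  rw [setLIntegral_congr (ae_eq_inter_coord_ne_zero volume_coord_eq_zero _), ← himg,
    lintegral_image_coordExp hsm inter_subset_left]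
  have hint : ∀ ζ : EuclideanSpace ℂ (Fin n), ENNReal.ofReal (∏ j, ‖coordExp ζ j‖ ^ 2) *
      ENNReal.ofReal (‖complexGrad (monomialFun A) (coordExp ζ)‖ ^ 2)
      = ENNReal.ofReal (Real.exp (2 * ⟪exponentVec A, ζ⟫)) * ENNReal.ofReal (gradWeight A ζ) := by
    intro ζ
    rw [← ENNReal.ofReal_mul (by positivity), ← ENNReal.ofReal_mul (by positivity),
      prod_norm_sq_mul_norm_complexGrad_sq, norm_monomialFun_coordExp, ← Real.exp_nat_mul,
      Nat.cast_ofNat]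
  simp_rw [hint]
  have hgm : Measurable fun ζ : EuclideanSpace ℂ (Fin n) =>
      ENNReal.ofReal (Real.exp (2 * ⟪exponentVec A, ζ⟫)) * ENNReal.ofReal (gradWeight A ζ) := by
    refine Measurable.mul (Measurable.ennreal_ofReal ?_)
      (continuous_gradWeight A).measurable.ennreal_ofReal
    exact Continuous.measurable (by fun_prop)
  rw [← lintegral_indicator hsm, lintegral_eq_lintegral_lintegral_orthogonal (norm_exponentDir hA)
    (hgm.indicator hsm), ← lintegral_indicator measurableSet_Iio]
  refine lintegral_congr fun t => ?_
  have hmem : ∀ v : (ℝ ∙ exponentDir A)ᗮ,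
      ⟪exponentVec A, t • exponentDir A + v⟫ < Real.log ε ↔ t ∈ Iio (Real.log ε / k) := by
    intro v
    rw [inner_exponentVec_smul_add hA, mem_Iio, lt_div_iff₀ hk]
  by_cases ht : t ∈ Iio (Real.log ε / k)
  · rw [indicator_of_mem ht, sliceMass, ← lintegral_const_mul' _ _ ENNReal.ofReal_ne_top]
    refine lintegral_congr fun v => ?_
    by_cases hv : t • exponentDir A + (v : EuclideanSpace ℂ (Fin n)) ∈ logStrip n
    · have hv' : t • exponentDir A + (v : EuclideanSpace ℂ (Fin n)) ∈ s := ⟨hv, (hmem v).2 ht⟩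
      rw [indicator_of_mem hv, indicator_of_mem hv', inner_exponentVec_smul_add hA]
      congr 3
      ring
    · have hv' : t • exponentDir A + (v : EuclideanSpace ℂ (Fin n)) ∉ s := fun h => hv h.1
      rw [indicator_of_notMem hv, indicator_of_notMem hv', mul_zero]
  · rw [indicator_of_notMem ht, ← lintegral_zero]
    refine lintegral_congr fun v => indicator_of_notMem (fun h => ht ((hmem v).1 h.2)) _

end EnergyFormulas

/-! ### The slice mass is antitone with finite positive supremum -/

section SliceMass

open Module Set
open scoped RealInnerProductSpace ENNReal

variable {n : ℕ}

/-- On slices, a shift along `e = exponentDir A` can be traded for a shift along the `i`-th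
coordinate vector, since the two differ by a translation inside `e^⊥`. -/
theorem lintegral_slice_eq_lintegral_add_single {A : Fin n → ℕ} {i : Fin n} (hi : A i ≠ 0) (t : ℝ)
    (g : EuclideanSpace ℂ (Fin n) → ℝ≥0∞) :
    ∫⁻ v : (ℝ ∙ exponentDir A)ᗮ, g (t • exponentDir A + v)
      = ∫⁻ v : (ℝ ∙ exponentDir A)ᗮ,
        g (v + (t * (‖exponentVec A‖ / A i)) • EuclideanSpace.single i (1 : ℂ)) := by
  have hA : ∃ j, A j ≠ 0 := ⟨i, hi⟩
  have hk := (norm_exponentVec_pos hA).ne'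
  have hi' : (A i : ℝ) ≠ 0 := Nat.cast_ne_zero.2 hi
  have hinner : ⟪exponentVec A, EuclideanSpace.single i (1 : ℂ)⟫ = A i := by
    rw [real_inner_eq_sum, Finset.sum_eq_single i]
    · simp [exponentVec]
    · intro j _ hj
      simp [hj]
    · simp
  have hmem : (t * (‖exponentVec A‖ / A i)) • EuclideanSpace.single i (1 : ℂ) - t • exponentDir A
      ∈ (ℝ ∙ exponentDir A)ᗮ := by
    rw [Submodule.mem_orthogonal_singleton_iff_inner_right, inner_sub_right, real_inner_smul_right,
      real_inner_smul_right, real_inner_self_eq_norm_sq, norm_exponentDir hA, exponentDir,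
      real_inner_smul_left, hinner]
    field_simp
    ring
  rw [← lintegral_add_right_eq_self _ (⟨_, hmem⟩ : (ℝ ∙ exponentDir A)ᗮ)]
  refine lintegral_congr fun v => congrArg g ?_
  simp only [Submodule.coe_add]
  abel

/-- The density `∏ j ≠ i, ‖z j‖ ^ 2` at `z = coordExp ζ`, restricted to `logStrip n`. -/
noncomputable def coordDensity (i : Fin n) (ζ : EuclideanSpace ℂ (Fin n)) : ℝ≥0∞ :=
  (logStrip n).indicator
    (fun ζ => ENNReal.ofReal (∏ j ∈ Finset.univ.erase i, Real.exp (2 * (ζ j).re))) ζ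

theorem prod_erase_exp_add_single (i : Fin n) (ζ : EuclideanSpace ℂ (Fin n)) (s : ℝ) :
    ∏ j ∈ Finset.univ.erase i,
        Real.exp (2 * ((ζ + s • EuclideanSpace.single i (1 : ℂ)) j).re)
      = ∏ j ∈ Finset.univ.erase i, Real.exp (2 * (ζ j).re) := by
  refine Finset.prod_congr rfl fun j hj => ?_
  simp [Finset.ne_of_mem_erase hj]

/-- The set of logarithmic coordinates with all imaginary parts in `(-π, π]` and all real parts
except the `i`-th negative. -/
def logStripOff (i : Fin n) : Set (EuclideanSpace ℂ (Fin n)) :=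
  {ζ | (∀ j, (ζ j).im ∈ Ioc (-Real.pi) Real.pi) ∧ ∀ j ≠ i, (ζ j).re < 0}

theorem mem_logStrip_add_single_iff (i : Fin n) (ζ : EuclideanSpace ℂ (Fin n)) (s : ℝ) :
    ζ + s • EuclideanSpace.single i (1 : ℂ) ∈ logStrip n ↔
      ζ ∈ logStripOff i ∧ (ζ i).re + s < 0 := by
  have him : ∀ j, ((ζ + s • EuclideanSpace.single i (1 : ℂ)) j).im = (ζ j).im := by
    intro j
    rcases eq_or_ne j i with rfl | hj
    · simp
    · simp [hj]
  have hre : ∀ j ≠ i, ((ζ + s • EuclideanSpace.single i (1 : ℂ)) j).re = (ζ j).re := by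
    intro j hj
    simp [hj]
  have hrei : ((ζ + s • EuclideanSpace.single i (1 : ℂ)) i).re = (ζ i).re + s := by simp
  constructor
  · intro h
    exact ⟨⟨fun j => him j ▸ (h j).2, fun j hj => hre j hj ▸ (h j).1⟩, hrei ▸ (h i).1⟩
  · rintro ⟨⟨h1, h2⟩, h3⟩ j
    refine ⟨?_, (him j).symm ▸ h1 j⟩
    rcases eq_or_ne j i with rfl | hj
    · exact hrei.symm ▸ h3
    · exact (hre j hj).symm ▸ h2 j hj

/-- The density `∏ j ≠ i, ‖z j‖ ^ 2` at `z = coordExp ζ`, restricted to `logStripOff i`. It is the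
increasing limit of the translates of `coordDensity i` along the `i`-th coordinate vector. -/
noncomputable def limitDensity (i : Fin n) (ζ : EuclideanSpace ℂ (Fin n)) : ℝ≥0∞ :=
  (logStripOff i).indicator
    (fun ζ => ENNReal.ofReal (∏ j ∈ Finset.univ.erase i, Real.exp (2 * (ζ j).re))) ζ

theorem coordDensity_add_single (i : Fin n) (ζ : EuclideanSpace ℂ (Fin n)) (s : ℝ) :
    coordDensity i (ζ + s • EuclideanSpace.single i (1 : ℂ))
      = if (ζ i).re + s < 0 then limitDensity i ζ else 0 := by
  rw [coordDensity, limitDensity]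
  split_ifs with h
  · by_cases h' : ζ ∈ logStripOff i
    · rw [indicator_of_mem ((mem_logStrip_add_single_iff i ζ s).2 ⟨h', h⟩), indicator_of_mem h',
        prod_erase_exp_add_single]
    · rw [indicator_of_notMem fun hm => h' ((mem_logStrip_add_single_iff i ζ s).1 hm).1,
        indicator_of_notMem h']
  · exact indicator_of_notMem (fun hm => h ((mem_logStrip_add_single_iff i ζ s).1 hm).2) _

theorem measurable_coordDensity (i : Fin n) : Measurable (coordDensity (n := n) i) := by
  refine Measurable.indicator (Measurable.ennreal_ofReal (Continuous.measurable ?_))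
    measurableSet_logStrip
  have h : ∀ j : Fin n, Continuous fun ζ : EuclideanSpace ℂ (Fin n) => (ζ j).re := fun j =>
    Complex.continuous_re.comp (continuous_coord j)
  fun_prop

theorem sliceMass_eq_sum (A : Fin n → ℕ) (t : ℝ) :
    sliceMass A t = ∑ i, ENNReal.ofReal ((A i : ℝ) ^ 2) *
      ∫⁻ v : (ℝ ∙ exponentDir A)ᗮ, coordDensity i (t • exponentDir A + v) := by
  have hm : ∀ i, Measurable fun v : (ℝ ∙ exponentDir A)ᗮ =>
      coordDensity i (t • exponentDir A + (v : EuclideanSpace ℂ (Fin n))) := fun i =>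
    (measurable_coordDensity i).comp (measurable_const.add measurable_subtype_coe)
  simp_rw [← lintegral_const_mul _ (hm _)]
  rw [← lintegral_finsetSum _ fun i _ => (hm i).const_mul _, sliceMass]
  refine lintegral_congr fun v => ?_
  by_cases hv : t • exponentDir A + (v : EuclideanSpace ℂ (Fin n)) ∈ logStrip n
  · simp only [coordDensity, indicator_of_mem hv]
    rw [gradWeight, ENNReal.ofReal_sum_of_nonneg fun i _ => by positivity]
    exact Finset.sum_congr rfl fun i _ => ENNReal.ofReal_mul (by positivity)
  · simp [coordDensity, indicator_of_notMem hv]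

theorem sliceMass_antitone (A : Fin n → ℕ) : Antitone (sliceMass A) := by
  intro t t' htt'
  rw [sliceMass_eq_sum, sliceMass_eq_sum]
  refine Finset.sum_le_sum fun i _ => ?_
  rcases eq_or_ne (A i) 0 with h0 | h0
  · simp [h0]
  · refine mul_le_mul_right ?_ _
    rw [lintegral_slice_eq_lintegral_add_single h0, lintegral_slice_eq_lintegral_add_single h0]
    refine lintegral_mono fun v => ?_
    simp only [coordDensity_add_single]
    have hle : t * (‖exponentVec A‖ / A i) ≤ t' * (‖exponentVec A‖ / A i) :=
      mul_le_mul_of_nonneg_right htt' (by positivity)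
    split_ifs with h1 h2
    · exact le_rfl
    · exact absurd (by linarith) h2
    · exact zero_le
    · exact le_rfl

theorem volume_unitPolydisc_lt_top : volume (unitPolydisc n) < ∞ := by
  refine (Metric.isBounded_iff_subset_closedBall 0).2 ⟨√n, fun z hz => ?_⟩ |>.measure_lt_top
  rw [mem_closedBall_zero_iff, EuclideanSpace.norm_eq]
  refine Real.sqrt_le_sqrt ?_
  calc ∑ j, ‖z j‖ ^ 2 ≤ ∑ _j : Fin n, (1 : ℝ) :=
        Finset.sum_le_sum fun j _ => pow_le_one₀ (norm_nonneg _) (hz j).le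
    _ = n := by simp

/-- The limit density has finite mass on `e^⊥`: integrated against the missing factor
`‖z i‖ ^ 2` along the `i`-th coordinate it gives at most the volume of the polydisc. -/
theorem lintegral_limitDensity_lt_top {A : Fin n → ℕ} {i : Fin n} (hi : A i ≠ 0) :
    ∫⁻ v : (ℝ ∙ exponentDir A)ᗮ, limitDensity i v < ∞ := by
  have hA : ∃ j, A j ≠ 0 := ⟨i, hi⟩
  set c := ‖exponentVec A‖ / A i with hc
  have hc0 : 0 < c := div_pos (norm_exponentVec_pos hA) (Nat.cast_pos.2 (Nat.pos_of_ne_zero hi))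
  set K : EuclideanSpace ℂ (Fin n) → ℝ≥0∞ := fun ζ =>
    ENNReal.ofReal (Real.exp (2 * (ζ i).re)) * coordDensity i ζ with hK
  have hKm : Measurable K := by
    refine Measurable.mul (Measurable.ennreal_ofReal (Continuous.measurable ?_))
      (measurable_coordDensity i)
    have : Continuous fun ζ : EuclideanSpace ℂ (Fin n) => (ζ i).re :=
      Complex.continuous_re.comp (continuous_coord i)
    fun_prop
  have hKvol : ∫⁻ ζ, K ζ < ∞ := by
    have h1 := lintegral_image_coordExp (n := n) measurableSet_logStrip subset_rfl 1
    have h2 : ∫⁻ ζ, K ζ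
        = ∫⁻ z in coordExp '' logStrip n, (1 : EuclideanSpace ℂ (Fin n) → ℝ≥0∞) z := by
      rw [h1, ← lintegral_indicator measurableSet_logStrip]
      refine lintegral_congr fun ζ => ?_
      by_cases hζ : ζ ∈ logStrip n
      · simp only [hK, coordDensity, indicator_of_mem hζ]
        rw [← ENNReal.ofReal_mul (Real.exp_nonneg _),
          Finset.mul_prod_erase Finset.univ (fun j => Real.exp (2 * (ζ j).re)) (Finset.mem_univ i)]
        simp [norm_sq_coordExp]
      · simp only [hK, coordDensity, indicator_of_notMem hζ, mul_zero]
    rw [h2]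
    simp only [Pi.one_apply, lintegral_const, Measure.restrict_apply MeasurableSet.univ, univ_inter,
      one_mul, image_coordExp_logStrip]
    exact (measure_mono fun z hz => hz.1).trans_lt volume_unitPolydisc_lt_top
  have hswap : ∫⁻ ζ, K ζ = ∫⁻ v : (ℝ ∙ exponentDir A)ᗮ, ∫⁻ t : ℝ,
      K (v + (t * c) • EuclideanSpace.single i (1 : ℂ)) := by
    rw [lintegral_eq_lintegral_lintegral_orthogonal (norm_exponentDir hA) hKm]
    simp_rw [lintegral_slice_eq_lintegral_add_single hi]
    refine lintegral_lintegral_swap (Measurable.aemeasurable (hKm.comp ?_))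
    refine Continuous.measurable ?_
    fun_prop
  -- on an interval of length one the `t`-integrand is at least `exp (-2c)` times its limit
  have hlow : ∀ v : (ℝ ∙ exponentDir A)ᗮ, ENNReal.ofReal (Real.exp (-(2 * c))) * limitDensity i v
      ≤ ∫⁻ t : ℝ, K (v + (t * c) • EuclideanSpace.single i (1 : ℂ)) := by
    intro v
    set x := ((v : EuclideanSpace ℂ (Fin n)) i).re with hx
    calc ENNReal.ofReal (Real.exp (-(2 * c))) * limitDensity i v
        = ∫⁻ _ in Ioo (-x / c - 1) (-x / c),
            ENNReal.ofReal (Real.exp (-(2 * c))) * limitDensity i v := by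
          rw [setLIntegral_const, Real.volume_Ioo]
          simp
      _ ≤ ∫⁻ t in Ioo (-x / c - 1) (-x / c), K (v + (t * c) • EuclideanSpace.single i (1 : ℂ)) := by
          refine setLIntegral_mono' measurableSet_Ioo fun t ht => ?_
          have h1 : x + t * c < 0 := by
            have := (lt_div_iff₀ hc0).1 ht.2
            linarith
          have h2 : -c ≤ x + t * c := by
            have := ht.1
            rw [sub_lt_iff_lt_add, div_lt_iff₀ hc0] at this
            linarith
          simp only [hK, coordDensity_add_single, ← hx, if_pos h1]
          refine mul_le_mul_left (ENNReal.ofReal_le_ofReal (Real.exp_le_exp.2 ?_)) _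
          have : (((v : EuclideanSpace ℂ (Fin n)) + (t * c) • EuclideanSpace.single i (1 : ℂ)) i).re
              = x + t * c := by simp [hx]
          rw [this]
          linarith
      _ ≤ _ := setLIntegral_le_lintegral _ _
  have hlt : ENNReal.ofReal (Real.exp (-(2 * c))) *
      ∫⁻ v : (ℝ ∙ exponentDir A)ᗮ, limitDensity i v < ∞ := by
    rw [← lintegral_const_mul' _ _ ENNReal.ofReal_ne_top]
    exact ((lintegral_mono hlow).trans_eq hswap.symm).trans_lt hKvol
  exact ENNReal.lt_top_of_mul_ne_top_right hlt.ne
    (ENNReal.ofReal_pos.2 (Real.exp_pos _)).ne'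

theorem iSup_sliceMass_lt_top (A : Fin n → ℕ) : ⨆ t, sliceMass A t < ∞ := by
  have hbound : ∀ t, sliceMass A t ≤ ∑ i, ENNReal.ofReal ((A i : ℝ) ^ 2) *
      ∫⁻ v : (ℝ ∙ exponentDir A)ᗮ, limitDensity i v := by
    intro t
    rw [sliceMass_eq_sum]
    refine Finset.sum_le_sum fun i _ => ?_
    rcases eq_or_ne (A i) 0 with h0 | h0
    · simp [h0]
    · refine mul_le_mul_right ?_ _
      rw [lintegral_slice_eq_lintegral_add_single h0]
      refine lintegral_mono fun v => ?_
      rw [coordDensity_add_single]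
      split_ifs
      · exact le_rfl
      · exact zero_le
  refine (iSup_le hbound).trans_lt (ENNReal.sum_lt_top.2 fun i _ => ?_)
  rcases eq_or_ne (A i) 0 with h0 | h0
  · simp [h0]
  · exact ENNReal.mul_lt_top ENNReal.ofReal_lt_top (lintegral_limitDensity_lt_top h0)

theorem volume_logStrip_pos : 0 < volume (logStrip n) := by
  set O : Set (EuclideanSpace ℂ (Fin n)) :=
    ⋂ j, {ζ | (ζ j).re < 0 ∧ (ζ j).im ∈ Ioo (-Real.pi) Real.pi} with hO
  have hopen : IsOpen O := isOpen_iInter_of_finite fun j =>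
    (isOpen_lt (Complex.continuous_re.comp (continuous_coord j)) continuous_const).inter
      (isOpen_Ioo.preimage (Complex.continuous_im.comp (continuous_coord j)))
  have hne : O.Nonempty := by
    refine ⟨WithLp.toLp 2 fun _ => -1, ?_⟩
    simp [hO, Real.pi_pos]
  refine (hopen.measure_pos volume hne).trans_le (measure_mono fun ζ hζ j => ?_)
  have := mem_iInter.1 hζ j
  exact ⟨this.1, Ioo_subset_Ioc_self this.2⟩

theorem iSup_sliceMass_pos {A : Fin n → ℕ} (hA : ∃ j, A j ≠ 0) : 0 < ⨆ t, sliceMass A t := by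
  by_contra h
  have hzero : ∀ t, sliceMass A t = 0 := by simpa using h
  have hm : Measurable fun ζ => ENNReal.ofReal (gradWeight A ζ) :=
    (continuous_gradWeight A).measurable.ennreal_ofReal
  have hF := lintegral_eq_lintegral_lintegral_orthogonal (norm_exponentDir hA)
    (hm.indicator measurableSet_logStrip)
  have hint : ∀ t : ℝ, (∫⁻ v : (ℝ ∙ exponentDir A)ᗮ,
      (logStrip n).indicator (fun ζ => ENNReal.ofReal (gradWeight A ζ)) (t • exponentDir A + v))
      = 0 := hzero
  simp_rw [hint, lintegral_zero] at hF
  rw [lintegral_indicator measurableSet_logStrip, setLIntegral_eq_zero_iff measurableSet_logStrip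
    hm] at hF
  have hpos : ∀ ζ, 0 < gradWeight A ζ := by
    intro ζ
    obtain ⟨i, hi⟩ := hA
    have : (0 : ℝ) < A i := Nat.cast_pos.2 (Nat.pos_of_ne_zero hi)
    exact Finset.sum_pos' (fun j _ => by positivity) ⟨i, Finset.mem_univ i, by positivity⟩
  refine volume_logStrip_pos.ne' (measure_mono_null (fun ζ hζ => ?_) (ae_iff.1 hF))
  intro h
  exact (ENNReal.ofReal_pos.2 (hpos ζ)).ne' (h hζ)

end SliceMass

/-! ### Asymptotics of the two energies -/

section Asymptotics

open Set
open scoped ENNReal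

variable {n : ℕ}

theorem levelEnergy_eq {A : Fin n → ℕ} (hA : ∃ j, A j ≠ 0) {ε : ℝ} (hε : 0 < ε) :
    levelEnergy (monomialFun A) ε
      = ε / ‖exponentVec A‖ * (sliceMass A (Real.log ε / ‖exponentVec A‖)).toReal := by
  rw [levelEnergy, integral_eq_lintegral_of_nonneg_ae (ae_of_all _ fun z => norm_nonneg _)
    (continuous_complexGrad_monomialFun A).norm.measurable.aestronglyMeasurable,
    lintegral_level_eq hA hε, ENNReal.toReal_mul, ENNReal.toReal_ofReal (by positivity)]

theorem lintegral_exp_Iio {a : ℝ} (ha : 0 < a) (T : ℝ) :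
    ∫⁻ t in Iio T, ENNReal.ofReal (Real.exp (a * t)) = ENNReal.ofReal (Real.exp (a * T) / a) := by
  rw [setLIntegral_congr Iio_ae_eq_Iic, ← integral_exp_mul_Iic ha,
    ofReal_integral_eq_lintegral_ofReal (integrableOn_exp_mul_Iic ha T)
      (ae_of_all _ fun t => Real.exp_nonneg _)]

theorem sublevelEnergy_bounds {A : Fin n → ℕ} (hA : ∃ j, A j ≠ 0) {ε : ℝ} (hε : 0 < ε) :
    ε ^ 2 / (2 * ‖exponentVec A‖) * (sliceMass A (Real.log ε / ‖exponentVec A‖)).toReal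
      ≤ sublevelEnergy (monomialFun A) ε ∧
    sublevelEnergy (monomialFun A) ε
      ≤ ε ^ 2 / (2 * ‖exponentVec A‖) * (⨆ t, sliceMass A t).toReal := by
  have hk := norm_exponentVec_pos hA
  set k := ‖exponentVec A‖
  set T := Real.log ε / k
  have hM : ∫⁻ t in Iio T, ENNReal.ofReal (Real.exp (2 * k * t))
      = ENNReal.ofReal (ε ^ 2 / (2 * k)) := by
    rw [lintegral_exp_Iio (by positivity), show 2 * k * T = (2 : ℕ) * Real.log ε by
      simp only [T, Nat.cast_ofNat]; field_simp, Real.exp_nat_mul, Real.exp_log hε]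
  have hJ : sublevelEnergy (monomialFun A) ε
      = (∫⁻ t in Iio T, ENNReal.ofReal (Real.exp (2 * k * t)) * sliceMass A t).toReal := by
    rw [sublevelEnergy, integral_eq_lintegral_of_nonneg_ae (ae_of_all _ fun z => sq_nonneg _)
      ((continuous_complexGrad_monomialFun A).norm.measurable.pow_const 2).aestronglyMeasurable,
      lintegral_sublevel_eq hA hε]
  have hsup := (iSup_sliceMass_lt_top A).ne
  have hup : ∫⁻ t in Iio T, ENNReal.ofReal (Real.exp (2 * k * t)) * sliceMass A t
      ≤ ENNReal.ofReal (ε ^ 2 / (2 * k)) * ⨆ t, sliceMass A t := by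
    rw [← hM, ← lintegral_mul_const' _ _ hsup]
    exact lintegral_mono fun t => mul_le_mul_right (le_iSup (sliceMass A) t) _
  have hlow : ENNReal.ofReal (ε ^ 2 / (2 * k)) * sliceMass A T
      ≤ ∫⁻ t in Iio T, ENNReal.ofReal (Real.exp (2 * k * t)) * sliceMass A t := by
    rw [← hM, ← lintegral_mul_const' _ _ (ne_top_of_le_ne_top hsup (le_iSup (sliceMass A) T))]
    exact setLIntegral_mono' measurableSet_Iio fun t ht =>
      mul_le_mul_right (sliceMass_antitone A (le_of_lt ht)) _
  have htop := ENNReal.mul_ne_top (ENNReal.ofReal_ne_top (r := ε ^ 2 / (2 * k))) hsup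
  have hnn : 0 ≤ ε ^ 2 / (2 * k) := by positivity
  rw [hJ]
  constructor
  · have := ENNReal.toReal_mono (ne_top_of_le_ne_top htop hup) hlow
    rwa [ENNReal.toReal_mul, ENNReal.toReal_ofReal hnn] at this
  · have := ENNReal.toReal_mono htop hup
    rwa [ENNReal.toReal_mul, ENNReal.toReal_ofReal hnn] at this

theorem tendsto_sliceMass_log {A : Fin n → ℕ} (hA : ∃ j, A j ≠ 0) :
    Tendsto (fun ε => (sliceMass A (Real.log ε / ‖exponentVec A‖)).toReal /
      (⨆ t, sliceMass A t).toReal) (𝓝[>] 0) (𝓝 1) := by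
  have hsup := (iSup_sliceMass_lt_top A).ne
  have hpos : 0 < (⨆ t, sliceMass A t).toReal :=
    ENNReal.toReal_pos (iSup_sliceMass_pos hA).ne' hsup
  have hlog : Tendsto (fun ε => Real.log ε / ‖exponentVec A‖) (𝓝[>] 0) atBot :=
    Real.tendsto_log_nhdsGT_zero.atBot_div_const (norm_exponentVec_pos hA)
  have h := ((ENNReal.tendsto_toReal hsup).comp
    ((tendsto_atBot_iSup (sliceMass_antitone A)).comp hlog)).div_const (⨆ t, sliceMass A t).toReal
  rwa [div_self hpos.ne'] at h

end Asymptotics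

theorem proposition2p4 (n : ℕ) (A : Fin n → ℕ) (hA : ∃ j, A j ≠ 0) :
    ∃ c : ℝ, 0 < c ∧
      Tendsto (fun ε : ℝ => levelEnergy (monomialFun A) ε / (c * ε)) (𝓝[>] 0) (𝓝 1) ∧
      Tendsto (fun ε : ℝ => sublevelEnergy (monomialFun A) ε / (c / 2 * ε ^ 2)) (𝓝[>] 0) (𝓝 1) := by
  have hk := norm_exponentVec_pos hA
  have hpos : 0 < (⨆ t, sliceMass A t).toReal :=
    ENNReal.toReal_pos (iSup_sliceMass_pos hA).ne' (iSup_sliceMass_lt_top A).ne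
  refine ⟨(⨆ t, sliceMass A t).toReal / ‖exponentVec A‖, div_pos hpos hk, ?_, ?_⟩
  · refine (tendsto_sliceMass_log hA).congr' ?_
    filter_upwards [self_mem_nhdsWithin] with ε hε
    have hε : 0 < ε := hε
    rw [levelEnergy_eq hA hε]
    field_simp
  · refine tendsto_of_tendsto_of_tendsto_of_le_of_le' (tendsto_sliceMass_log hA)
      tendsto_const_nhds ?_ ?_
    · filter_upwards [self_mem_nhdsWithin] with ε hε
      have hε : 0 < ε := hε
      rw [le_div_iff₀ (by positivity)]
      refine le_of_eq_of_le ?_ (sublevelEnergy_bounds hA hε).1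
      field_simp
    · filter_upwards [self_mem_nhdsWithin] with ε hε
      have hε : 0 < ε := hε
      rw [div_le_one (by positivity)]
      refine (sublevelEnergy_bounds hA hε).2.trans_eq ?_
      field_simp
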